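/- **Conventions.** A (one-sorted) local language $L$ is a first-order language with equality and with the $0$-ary relations $\bot,\top$, having no function symbols except constants, together with a partially ordered commutative monoid $(\mathtt D,\ast,\preceq)$ of binary relation symbols (the locality relations), whose identity is the equality symbol and is also the least element of $\mathtt D$, and with a function assigning to each pair $c_1,c_2$ of constants a bound $B_{c_1,c_2}\in\mathtt D$. A local structure is a non-empty $L$-structure in which (A1) every $d\in\mathtt D$ is symmetric; (A2) $d_1\preceq d_2$ implies $d_1\subseteq d_2$; (A3) $d_1\circ d_2\subseteq d_1\ast d_2$; (A4) $B_{c_1,c_2}(c_1,c_2)$ holds for all constants $c_1,c_2$; (A5) any two elements $a,b$ satisfy $d(a,b)$ for some $d\in\mathtt D$. Positive formulas are built from atomic formulas by $\wedge,\vee,\exists$; a negative sentence is the negation of a positive sentence; $\mathrm{Th}_-(M)$ is the set of negative sentences true in $M$. A negative local theory is a set $T$ of negative sentences that contains every negative sentence true in all local models of $T$ (a local model is a local structure satisfying $T$); $T$ is locally satisfiable if it has a local model; and $T_+$ is the set of positive sentences whose negation is not in $T$. A homomorphism $f\colon A\to B$ is a positive embedding if $B\models\varphi(f(a))$ implies $A\models\varphi(a)$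 for all positive $\varphi(x)$ and all tuples $a$ of $A$. A local model $M$ of $T$ is locally positively closed if every homomorphism from $M$ to a local model of $T$ is a positive embedding. For a locally satisfiable negative local theory $T$ consider the following properties. - (I) $T$ is irreducible: for all positive $\varphi(x),\psi(y)$ with $x,y$ disjoint finite tuples of variables of the same length, $\exists x\,\varphi\in T_+$ and $\exists y\,\psi\in T_+$ imply $\exists xy\,(\varphi\wedge\psi)\in T_+$. - (UI) $T$ is uniformly irreducible: there is $d\in\mathtt D$ such that for all such $\varphi,\psi$, $\exists x\,\varphi\in T_+$ and $\exists y\,\psi\in T_+$ imply $\exists xy\,(\bigwedge_i d(x_i,y_i)\wedge\varphi\wedge\psi)\in T_+$. - (LJCP) any two local models of $T$ admit homomorphisms to a common local model of $T$. - (wC) $T$ is weakly complete: $T=\mathrm{Th}_-(M)$ for some locally positively closed model $M$ of $T$. - (C) $T$ is complete: $T=\mathrm{Th}_-(M)$ for every locally positively closed model $M$ of $T$. **Statement.** None of the implications in the chain (UI) $\Rightarrow$ (LJCP) $\Rightarrow$ (C) $\Rightarrow$ (wC) $\Rightarrow$ (I) can be reversed. More precisely, in the languages below, where the locality relations are $\{d_n\}_{n\in\mathbb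 N}$ with the ordered monoid structure of $\mathbb N$ (so $d_0$ is equality), each of the following four theories is a locally satisfiable negative local theory with the stated properties. 1. ((wC) $\not\Rightarrow$ (C)) Let the language have, besides the $d_n$, unary predicates $P_n,Q_n$ ($n\in\mathbb N$) and no constants, and let $Z$ have universe $\mathbb Z$, with $d_n(x,y)\Leftrightarrow|x-y|\le n$, $P_n(x)\Leftrightarrow x\ge n$ and $Q_n(x)\Leftrightarrow x\le -n$. Then $\mathrm{Th}_-(Z)$ is weakly complete but not complete. 2. ((LJCP) $\not\Rightarrow$ (UI)) Let $Z$ be as in 1, and expand the language by one constant symbol, with bound $d_0$ for the pair consisting of the constant and itself, interpreted in $Z$ as $0$. Then the negative theory $\mathrm{Th}_-(Z/0)$ of this expansion has the local joint continuation property but is not uniformly irreducible. 3. ((C) $\not\Rightarrow$ (LJCP)) In the language of 1, let $M$ be the (non-local) structure with universe $2^\omega$, with $d_n(\eta,\zeta)\Leftrightarrow|\{i:\eta(i)\ne\zeta(i)\}|\le n$, $P_n(\eta)\Leftrightarrow\eta(n)=1$ and $Q_n(\eta)\Leftrightarrow\eta(n)=0$. Then $\mathrm{Th}_-(M)$ is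 complete but does not have the local joint continuation property. 4. ((I) $\not\Rightarrow$ (wC)) Let the language have, besides the $d_n$, unary predicates $P_\alpha$ ($\alpha<\omega_1$) and no constants. Let $\mathcal C$ be the class of structures with universe $\mathbb Z$ in which $d_n(a,b)\Leftrightarrow|a-b|\le n$ and the sets $P_\alpha$ are pairwise disjoint. Then the theory $\bigcap_{M\in\mathcal C}\mathrm{Th}_-(M)$ is irreducible but not weakly complete. -/

import Mathlib

universe u v w x

noncomputable section

namespace LocalPositiveLogic

open FirstOrder FirstOrder.Language

/-! ### Positive and negative formulas -/

/-- Positive formulas: built from atomic formulas (including the `0`-ary relations `⊥` and `⊤`)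
by conjunctions, disjunctions and existential quantifiers. -/
inductive IsPositive {L : FirstOrder.Language.{u, v}} {α : Type w} :
    ∀ {n : ℕ}, L.BoundedFormula α n → Prop
  | bot {n : ℕ} : IsPositive (⊥ : L.BoundedFormula α n)
  | top {n : ℕ} : IsPositive (⊤ : L.BoundedFormula α n)
  | equal {n : ℕ} (t₁ t₂ : L.Term (α ⊕ Fin n)) : IsPositive (t₁.bdEqual t₂)
  | rel {n k : ℕ} (R : L.Relations k) (ts : Fin k → L.Term (α ⊕ Fin n)) :
      IsPositive (R.boundedFormula ts)
  | inf {n : ℕ} {φ ψ : L.BoundedFormula α n} :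
      IsPositive φ → IsPositive ψ → IsPositive (φ ⊓ ψ)
  | sup {n : ℕ} {φ ψ : L.BoundedFormula α n} :
      IsPositive φ → IsPositive ψ → IsPositive (φ ⊔ ψ)
  | ex {n : ℕ} {φ : L.BoundedFormula α (n + 1)} : IsPositive φ → IsPositive φ.ex

/-- A negative sentence is the negation of a positive sentence. -/
def IsNegative {L : FirstOrder.Language.{u, v}} (σ : L.Sentence) : Prop :=
  ∃ φ : L.Sentence, IsPositive φ ∧ σ = BoundedFormula.not φ

/-- The negative theory `Th₋(M)`: the set of negative sentences satisfied by `M`. -/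
def negTheory (L : FirstOrder.Language.{u, v}) (M : Type x) [L.Structure M] : L.Theory :=
  {σ | IsNegative σ ∧ M ⊨ σ}

/-- The associated positive counterpart `T₊` of `T`: the positive sentences whose negations are not
in `T`. -/
def posPart {L : FirstOrder.Language.{u, v}} (T : L.Theory) : L.Theory :=
  {φ | IsPositive φ ∧ BoundedFormula.not φ ∉ T}

/-- The sentence `∃ x, φ(x)`, where `x` is the finite (multi-)variable indexed by `β`. -/
def existsAll {L : FirstOrder.Language.{u, v}} {β : Type} [Finite β] (φ : L.Formula β) : L.Sentence :=
  Formula.iExs β (Formula.relabel (Sum.inr : β → Empty ⊕ β) φ)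

/-- A homomorphism `f : A → B` is a positive embedding if `B ⊨ φ(f(a))` implies `A ⊨ φ(a)` for
every positive formula `φ(x)` and every tuple `a` of `A`. -/
def IsPositiveEmbedding {L : FirstOrder.Language.{u, v}} {A B : Type x} [L.Structure A] [L.Structure B]
    (f : A →[L] B) : Prop :=
  ∀ (n : ℕ) (φ : L.Formula (Fin n)), IsPositive φ →
    ∀ a : Fin n → A, φ.Realize (fun i => f (a i)) → φ.Realize a

/-! ### One-sorted local languages and local structures -/

/-- A local signature, with partially ordered commutative monoid `D` of locality relation symbols
(written additively), on the one-sorted first-order language `L`. The identity `0` of `D` is the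
equality symbol (which is a logical symbol) and is the least element of `D`; every other element of
`D` is a binary relation symbol of `L`. The only function symbols of `L` are constants. -/
structure LocalSignature (L : FirstOrder.Language.{u, v}) (D : Type w)
    [AddCommMonoid D] [PartialOrder D] [IsOrderedAddMonoid D] where
  isEmpty_functions : ∀ n : ℕ, IsEmpty (L.Functions (n + 1))
  zero_le : ∀ d : D, 0 ≤ d
  symb : {d : D // d ≠ 0} → L.Relations 2
  symb_injective : Function.Injective symb
  /-- The bound function. -/
  bound : L.Constants → L.Constants → D

namespace LocalSignature

variable {L : FirstOrder.Language.{u, v}} {D : Type w}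
  [AddCommMonoid D] [PartialOrder D] [IsOrderedAddMonoid D]

/-- The atomic formula `d(t₁, t₂)`. -/
def locFormula (S : LocalSignature L D) {α : Type} (d : D) (t₁ t₂ : L.Term α) : L.Formula α :=
  open Classical in if h : d = 0 then t₁.equal t₂ else (S.symb ⟨d, h⟩).formula₂ t₁ t₂

/-- The interpretation in `M` of the locality relation symbol `d`. -/
def locRel (S : LocalSignature L D) {M : Type x} [L.Structure M] (d : D) (a b : M) : Prop :=
  open Classical in if h : d = 0 then a = b else Structure.RelMap (S.symb ⟨d, h⟩) ![a, b]

/-- Local structures. -/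
structure IsLocal (S : LocalSignature L D) (M : Type x) [L.Structure M] : Prop where
  nonempty : Nonempty M
  symm : ∀ (d : D) (a b : M), S.locRel d a b → S.locRel d b a
  mono : ∀ d₁ d₂ : D, d₁ ≤ d₂ → ∀ a b : M, S.locRel d₁ a b → S.locRel d₂ a b
  comp : ∀ (d₁ d₂ : D) (a b c : M), S.locRel d₁ a b → S.locRel d₂ b c → S.locRel (d₁ + d₂) a c
  bound : ∀ c₁ c₂ : L.Constants, S.locRel (S.bound c₁ c₂) (c₁ : M) (c₂ : M)
  total : ∀ a b : M, ∃ d : D, S.locRel d a b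

/-- Local models of a set of sentences. -/
def IsLocalModel (S : LocalSignature L D) (T : L.Theory) (M : Type x) [L.Structure M] : Prop :=
  S.IsLocal M ∧ M ⊨ T

/-- `T` has a local model (with universe in `Type x`). -/
def LocallySatisfiable (S : LocalSignature L D) (T : L.Theory) : Prop :=
  ∃ (M : Type x) (_ : L.Structure M), S.IsLocalModel T M

/-- Local implication of a sentence: every local model of `T` satisfies `σ`. -/
def LocallyImplies (S : LocalSignature L D) (T : L.Theory) (σ : L.Sentence) : Prop :=
  ∀ (M : Type x) [L.Structure M], S.IsLocalModel T M → M ⊨ σ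

/-- A negative local theory: a set of negative sentences closed under local implication. -/
def IsNegativeLocalTheory (S : LocalSignature L D) (T : L.Theory) : Prop :=
  (∀ σ ∈ T, IsNegative σ) ∧
    ∀ σ : L.Sentence, IsNegative σ → LocallyImplies.{u, v, w, x} S T σ → σ ∈ T

/-- Locally positively closed models of `T`. -/
def IsPCModel (S : LocalSignature L D) (T : L.Theory) (M : Type x) [L.Structure M] : Prop :=
  S.IsLocalModel T M ∧
    ∀ (N : Type x) [L.Structure N], S.IsLocalModel T N →
      ∀ f : M →[L] N, IsPositiveEmbedding f

/-! ### Completeness properties -/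

/-- (I): irreducibility. -/
def Irreducible (_S : LocalSignature L D) (T : L.Theory) : Prop :=
  ∀ (n : ℕ) (φ ψ : L.Formula (Fin n)), IsPositive φ → IsPositive ψ →
    existsAll φ ∈ posPart T → existsAll ψ ∈ posPart T →
      existsAll (φ.relabel (Sum.inl : Fin n → Fin n ⊕ Fin n) ⊓
        ψ.relabel (Sum.inr : Fin n → Fin n ⊕ Fin n)) ∈ posPart T

/-- The formula `d(x, y)` for `n`-tuples of variables `x` and `y`: the conjunction of the
`d(xᵢ, yᵢ)`. -/
def locTupleFormula (S : LocalSignature L D) (d : D) (n : ℕ) : L.Formula (Fin n ⊕ Fin n) :=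
  Formula.iInf fun i : Fin n => S.locFormula d (Term.var (Sum.inl i)) (Term.var (Sum.inr i))

/-- `d`-irreducibility. -/
def IrreducibleAt (S : LocalSignature L D) (d : D) (T : L.Theory) : Prop :=
  ∀ (n : ℕ) (φ ψ : L.Formula (Fin n)), IsPositive φ → IsPositive ψ →
    existsAll φ ∈ posPart T → existsAll ψ ∈ posPart T →
      existsAll (S.locTupleFormula d n ⊓
        (φ.relabel (Sum.inl : Fin n → Fin n ⊕ Fin n) ⊓
          ψ.relabel (Sum.inr : Fin n → Fin n ⊕ Fin n))) ∈ posPart T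

/-- (UI): uniform irreducibility. -/
def UniformlyIrreducible (S : LocalSignature L D) (T : L.Theory) : Prop :=
  ∃ d : D, S.IrreducibleAt d T

/-- (LJCP): the local joint continuation property. -/
def LJCP (S : LocalSignature L D) (T : L.Theory) : Prop :=
  ∀ (A B : Type x) [L.Structure A] [L.Structure B], S.IsLocalModel T A → S.IsLocalModel T B →
    ∃ (M : Type x) (_ : L.Structure M), S.IsLocalModel T M ∧
      Nonempty (A →[L] M) ∧ Nonempty (B →[L] M)

/-- (wC): weak completeness. -/
def WeaklyComplete (S : LocalSignature L D) (T : L.Theory) : Prop :=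
  ∃ (M : Type x) (_ : L.Structure M), S.IsPCModel T M ∧ T = negTheory L M

/-- (C): completeness. -/
def Complete (S : LocalSignature L D) (T : L.Theory) : Prop :=
  ∀ (M : Type x) [L.Structure M], S.IsPCModel T M → T = negTheory L M

end LocalSignature

/-! ### The languages of the examples -/

/-- Function symbols: only constants, namely the elements of `C`. -/
def ExFunctions (C : Type) : ℕ → Type
  | 0 => C
  | _ + 1 => Empty

/-- Relation symbols: binary symbols `dₙ` for `n ≠ 0` (the symbol `d₀` being equality) and unary
predicates indexed by `ι`. -/
inductive ExRelations (ι : Type) : ℕ → Type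
  | d (n : {n : ℕ // n ≠ 0}) : ExRelations ι 2
  | pred (i : ι) : ExRelations ι 1

/-- The language with constants `C`, locality relations `dₙ` (`n : ℕ`) and unary predicates indexed
by `ι`. -/
def exLanguage (C ι : Type) : FirstOrder.Language.{0, 0} where
  Functions := ExFunctions C
  Relations := ExRelations ι

/-- The local signature on `exLanguage C ι` with locality relations `dₙ`, `n : ℕ`, ordered and added
as the natural numbers; all bounds between constants are `d₀` (this is only used when there is at
most one constant). -/
def exSignature (C ι : Type) : LocalSignature (exLanguage C ι) ℕ where
  isEmpty_functions := fun _ => inferInstanceAs (IsEmpty Empty)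
  zero_le := Nat.zero_le
  symb := ExRelations.d
  symb_injective := fun _ _ h => ExRelations.d.inj h
  bound := fun _ _ => 0

/-- The structure with universe `M` where the constant `i` is `c i`, the relation `dₙ` is `R n` (for
`n ≠ 0`) and the predicate `i` is `P i`. -/
@[reducible]
def exStructure {C ι : Type} (M : Type) (c : C → M) (R : ℕ → M → M → Prop) (P : ι → Set M) :
    (exLanguage C ι).Structure M where
  funMap := fun {n} f _ =>
    match n, f with
    | 0, i => c i
    | _ + 1, e => Empty.elim e
  RelMap := fun {_} r xs =>
    match r, xs with
    | ExRelations.d n, xs => R n (xs 0) (xs 1)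
    | ExRelations.pred i, xs => xs 0 ∈ P i

/-- The index type of the unary predicates `Pₙ`, `Qₙ`, `n : ℕ`. -/
inductive PQ : Type
  | P (n : ℕ) : PQ
  | Q (n : ℕ) : PQ

/-- The locality relations `|a - b| ≤ n` on `ℤ`. -/
def intDist (n : ℕ) (a b : ℤ) : Prop := |a - b| ≤ (n : ℤ)

/-- The predicates `Pₙ = [n, ∞)` and `Qₙ = (-∞, -n]` on `ℤ`. -/
def intervalPred : PQ → Set ℤ
  | PQ.P n => {a | (n : ℤ) ≤ a}
  | PQ.Q n => {a | a ≤ -(n : ℤ)}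

/-- The structure `Z`. -/
@[reducible]
def intervalStructure : (exLanguage Empty PQ).Structure ℤ :=
  exStructure ℤ Empty.elim intDist intervalPred

/-- `Th₋(Z)`. -/
def intervalTheory : (exLanguage Empty PQ).Theory :=
  @negTheory (exLanguage Empty PQ) ℤ intervalStructure

/-- The structure `Z` with a constant for `0`. -/
@[reducible]
def pointedIntervalStructure : (exLanguage Unit PQ).Structure ℤ :=
  exStructure ℤ (fun _ => 0) intDist intervalPred

/-- `Th₋(Z/0)`. -/
def pointedIntervalTheory : (exLanguage Unit PQ).Theory :=
  @negTheory (exLanguage Unit PQ) ℤ pointedIntervalStructure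

/-- The relations `|{i : η(i) ≠ ζ(i)}| ≤ n` on `2^ω` (with `true` for `1` and `false` for `0`). -/
def hammingDist (n : ℕ) (η ζ : ℕ → Bool) : Prop := {i : ℕ | η i ≠ ζ i}.encard ≤ (n : ℕ∞)

/-- The predicates `Pₙ = {η : η(n) = 1}` and `Qₙ = {η : η(n) = 0}` on `2^ω`. -/
def cantorPred : PQ → Set (ℕ → Bool)
  | PQ.P n => {η | η n = true}
  | PQ.Q n => {η | η n = false}

/-- The (non-local) structure with universe `2^ω`. -/
@[reducible]
def hammingStructure : (exLanguage Empty PQ).Structure (ℕ → Bool) :=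
  exStructure (ℕ → Bool) Empty.elim hammingDist cantorPred

/-- The negative theory of `2^ω`. -/
def hammingTheory : (exLanguage Empty PQ).Theory :=
  @negTheory (exLanguage Empty PQ) (ℕ → Bool) hammingStructure

/-- The set of countable ordinals, indexing the predicates `P_α`, `α < ω₁`. -/
abbrev OmegaOne : Type := (Ordinal.omega 1 : Ordinal.{0}).ToType

/-- The negative theory of the class of all structures with universe `ℤ`, locality relations
`|a - b| ≤ n`, and pairwise disjoint unary predicates `P_α`, `α < ω₁`. -/
def disjointTheory : (exLanguage Empty OmegaOne).Theory :=
  {σ | IsNegative σ ∧ ∀ P : OmegaOne → Set ℤ, (∀ α β : OmegaOne, α < β → P α ∩ P β = ∅) →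
    @Sentence.Realize (exLanguage Empty OmegaOne) ℤ (exStructure ℤ Empty.elim intDist P) σ}

end LocalPositiveLogic

end

open LocalPositiveLogic

/-!
Positive formulas only see finite pieces of a structure: if `φ(a)` holds in `N`, it is preserved by
every map which preserves the constants and, on a suitable finite set of elements, finitely many
relations (`IsPositive.exists_preservesOn`); conversely the diagram of a finite piece of `N` is
expressed by a positive sentence (`exists_isPositive_forall_exists_preservesOn`). So the models of
`Th₋(M)` are the structures `N` whose finite pieces map to `M` by such approximate homomorphisms
(`model_negTheory_iff_exists_preservesOn`). If in addition the values can be confined to compact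
sets and the relations of `M` are closed, an ultralimit of these is a homomorphism `N → M`
(`exists_hom_of_isCompact`). These facts replace saturation and compactness in all four examples.

* In `Z` each element is isolated by finitely many atomic facts, so a homomorphism from `Z` to a
  local model of `Th₋(Z)` has approximate left inverses; hence `Z` is locally positively closed and
  `Th₋(Z)` is weakly complete. But a single point in all `Pₙ` and in no `Qₙ` is also a locally
  positively closed model: a local model containing an element of `⋂ Pₙ` has no element in any
  `Qₘ`, and so retracts onto the point. It omits `∃ x, Q₀(x)`.
* With the constant `0`, an element at distance `m` from the constant can only be sent to
  `[-m, m]`, so every local model maps to `Z`, which gives joint continuation. Uniform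
  irreducibility at `d` is refuted by `P_{d+1}` and `Q₀`.
* All components of `2^ω` for finite Hamming distance have the negative theory of `2^ω`: change the
  coordinates beyond those in play to those of a fixed sequence. By compactness of `2^ω` every local
  model maps to a component, and a locally positively closed one does so by a positive embedding,
  which gives completeness. The components of the constant sequences cannot be joined, since
  an element of `⋂ Pₙ` and one of `⋂ Qₙ` are at no finite distance in a local model.
* Finite configurations on two lines can be placed disjointly on one line, which gives
  irreducibility. In a local structure with the theory of all lines, every `P_α` would be realised,
  so uncountably many within a fixed distance `m` of a given element; but on a line an interval of
  radius `m` meets at most `2m + 1` disjoint predicates.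
-/

universe y z

noncomputable section

namespace LocalPositiveLogic

open FirstOrder FirstOrder.Language

section General

variable {L : FirstOrder.Language.{u, v}} {α : Type w} {β : Type z}

/-! ### Positive formulas under syntactic operations -/

theorem IsPositive.boundedRelabel {m n : ℕ} {φ : L.BoundedFormula α m} (hφ : IsPositive φ)
    (g : α → β ⊕ Fin n) : IsPositive (BoundedFormula.relabel g φ) := by
  induction hφ with
  | bot => exact .bot
  | top => exact .top
  | equal t₁ t₂ => exact .equal _ _
  | rel R ts => exact .rel _ _
  | inf _ _ ih₁ ih₂ => exact .inf ih₁ ih₂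
  | sup _ _ ih₁ ih₂ => exact .sup ih₁ ih₂
  | ex _ ih => rw [BoundedFormula.relabel_ex]; exact .ex ih

theorem IsPositive.relabel {φ : L.Formula α} (hφ : IsPositive φ) (g : α → β) :
    IsPositive (Formula.relabel g φ) :=
  hφ.boundedRelabel _

theorem IsPositive.exs : ∀ {n : ℕ} {φ : L.BoundedFormula α n}, IsPositive φ → IsPositive φ.exs
  | 0, _, h => h
  | _ + 1, φ, h => IsPositive.exs (φ := φ.ex) (.ex h)

theorem IsPositive.iExs [Finite β] {φ : L.Formula (α ⊕ β)} (hφ : IsPositive φ) :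
    IsPositive (Formula.iExs β φ) :=
  (hφ.boundedRelabel _).exs

theorem IsPositive.existsAll {γ : Type} [Finite γ] {φ : L.Formula γ} (hφ : IsPositive φ) :
    IsPositive (existsAll φ) :=
  (hφ.relabel _).iExs

theorem IsPositive.iInf [Finite β] {f : β → L.Formula α} (hf : ∀ b, IsPositive (f b)) :
    IsPositive (Formula.iInf f) := by
  let _ := Fintype.ofFinite β
  have key : ∀ l : List β, IsPositive ((l.map f).foldr (· ⊓ ·) (⊤ : L.BoundedFormula α 0)) := by
    intro l
    induction l with
    | nil => exact .top
    | cons b l ih => exact .inf (hf b) ih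
  exact key _

theorem realize_existsAll {M : Type x} [L.Structure M] {γ : Type} [Finite γ] {φ : L.Formula γ} :
    M ⊨ existsAll φ ↔ ∃ a : γ → M, φ.Realize a := by
  simp only [Sentence.Realize, existsAll, Formula.realize_iExs, Formula.realize_relabel]
  rfl

/-! ### Negative theories -/

section NegTheory

variable {M : Type x} [L.Structure M] {N : Type y} [L.Structure N]

theorem not_mem_negTheory {φ : L.Sentence} (hφ : IsPositive φ) :
    BoundedFormula.not φ ∉ negTheory L M ↔ M ⊨ φ := by
  have h : M ⊨ (BoundedFormula.not φ : L.Sentence) ↔ ¬ M ⊨ φ := Sentence.realize_not M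
  constructor
  · intro h₁
    by_contra h₂
    exact h₁ ⟨⟨φ, hφ, rfl⟩, h.2 h₂⟩
  · exact fun h₁ h₂ => h.1 h₂.2 h₁

theorem model_negTheory_iff :
    N ⊨ negTheory L M ↔ ∀ φ : L.Sentence, IsPositive φ → N ⊨ φ → M ⊨ φ := by
  rw [Theory.model_iff]
  constructor
  · intro h φ hφ hN
    by_contra hM
    exact (Sentence.realize_not N).1 (h _ ⟨⟨φ, hφ, rfl⟩, (Sentence.realize_not M).2 hM⟩) hN
  · rintro h σ ⟨⟨φ, hφ, rfl⟩, hM⟩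
    exact (Sentence.realize_not N).2 fun hN => (Sentence.realize_not M).1 hM (h φ hφ hN)

theorem negTheory_eq (h₁ : N ⊨ negTheory L M) (h₂ : M ⊨ negTheory L N) :
    negTheory L M = negTheory L N :=
  Set.Subset.antisymm (fun _ hσ => ⟨hσ.1, h₁.realize_of_mem _ hσ⟩)
    fun _ hσ => ⟨hσ.1, h₂.realize_of_mem _ hσ⟩

end NegTheory

/-! ### Approximate homomorphisms -/

/-- A map preserving the constants of `L` and, on the finite set `S`, the relations in the finite
set `R`: a homomorphism up to a finite amount of information. -/
structure PreservesOn {N : Type x} {M : Type y} [L.Structure N] [L.Structure M]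
    (R : Finset (Σ k, L.Relations k)) (S : Finset N) (f : N → M) : Prop where
  map_constants : ∀ c : L.Constants, f (c : N) = (c : M)
  map_rel : ∀ {k : ℕ} (r : L.Relations k), ⟨k, r⟩ ∈ R → ∀ xs : Fin k → N, (∀ i, xs i ∈ S) →
    Structure.RelMap r xs → Structure.RelMap r (f ∘ xs)

variable {N : Type x} {M : Type y} [L.Structure N] [L.Structure M]

theorem PreservesOn.mono {R R' : Finset (Σ k, L.Relations k)} {S S' : Finset N} {f : N → M}
    (h : PreservesOn R S f) (hR : R' ⊆ R) (hS : S' ⊆ S) : PreservesOn R' S' f :=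
  ⟨h.map_constants, fun r hr xs hxs => h.map_rel r (hR hr) xs fun i => hS (hxs i)⟩

theorem PreservesOn.hom_comp {M' : Type z} [L.Structure M'] {R : Finset (Σ k, L.Relations k)}
    {S : Finset N} {f : N → M} (h : PreservesOn R S f) (g : M →[L] M') :
    PreservesOn R S (g ∘ f) :=
  ⟨fun c => (congrArg g (h.map_constants c)).trans (g.map_constants c),
    fun r hr xs hxs hrel => g.map_rel r _ (h.map_rel r hr xs hxs hrel)⟩

theorem preservesOn_hom [∀ n, IsEmpty (L.Functions (n + 1))] (f : N →[L] M)
    (R : Finset (Σ k, L.Relations k)) (S : Finset N) : PreservesOn R S f :=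
  ⟨fun c => f.map_constants c, fun r _ xs _ h => f.map_rel r xs h⟩

/-- The diagram of a finite piece of `N` is expressed by a positive sentence. -/
theorem exists_isPositive_forall_exists_preservesOn [Finite L.Constants]
    (R : Finset (Σ k, L.Relations k)) (S : Finset N) :
    ∃ σ : L.Sentence, IsPositive σ ∧ N ⊨ σ ∧
      ∀ (M : Type y) [L.Structure M] [Nonempty M], M ⊨ σ → ∃ f : N → M, PreservesOn R S f := by
  classical
  have := Fintype.ofFinite L.Constants
  -- the constants are added, so that their values are among the named elements
  let S' : Finset N := S ∪ Finset.univ.image fun c : L.Constants => (c : N)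
  let e : S' ≃ Fin S'.card := S'.equivFin
  let s : Fin S'.card → N := fun i => (e.symm i : N)
  -- the atomic facts about relations, and those about constants
  let F := {p : Σ r : R, Fin r.1.1 → Fin S'.card // Structure.RelMap p.1.1.2 (s ∘ p.2)}
  let φ : L.Formula (Fin S'.card) :=
    Formula.iInf (fun p : F => p.1.1.1.2.formula fun i => Term.var (p.1.2 i)) ⊓
      Formula.iInf fun c : {c : L.Constants × Fin S'.card // (c.1 : N) = s c.2} =>
        (Constants.term c.1.1).equal (Term.var c.1.2)
  refine ⟨existsAll φ, ?_, ?_, ?_⟩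
  · exact IsPositive.existsAll (.inf (.iInf fun p => .rel _ _) (.iInf fun c => .equal _ _))
  · rw [realize_existsAll]
    refine ⟨s, ?_⟩
    simp only [φ, Formula.realize_inf, Formula.realize_iInf, Formula.realize_rel,
      Formula.realize_equal, Term.realize_constants, Term.realize_var]
    exact ⟨fun p => p.2, fun c => c.2⟩
  · intro M _ _ hM
    obtain ⟨a, ha⟩ := realize_existsAll.1 hM
    simp only [φ, Formula.realize_inf, Formula.realize_iInf, Formula.realize_rel,
      Formula.realize_equal, Term.realize_constants, Term.realize_var] at ha
    have hs : ∀ b (hb : b ∈ S'), s (e ⟨b, hb⟩) = b := fun b hb => by simp [s]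
    refine ⟨fun b => if hb : b ∈ S' then a (e ⟨b, hb⟩) else Classical.arbitrary M, ?_, ?_⟩
    · intro c
      have hc : (c : N) ∈ S' := Finset.mem_union_right _
        (Finset.mem_image_of_mem _ (Finset.mem_univ c))
      rw [dif_pos hc]
      exact (ha.2 ⟨(c, _), (hs _ hc).symm⟩).symm
    · intro k r hr xs hxs hrel
      have hxs' : ∀ i, xs i ∈ S' := fun i => Finset.mem_union_left _ (hxs i)
      have := ha.1 ⟨⟨⟨⟨k, r⟩, hr⟩, fun i => e ⟨xs i, hxs' i⟩⟩, by
        convert hrel using 1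
        exact funext fun i => hs _ _⟩
      convert this using 1
      exact funext fun i => dif_pos (hxs' i)

variable [hL : ∀ n, IsEmpty (L.Functions (n + 1))]

theorem realize_comp_of_map_constants {f : N → M} (hf : ∀ c : L.Constants, f (c : N) = (c : M))
    (t : L.Term α) (v : α → N) : t.realize (f ∘ v) = f (t.realize v) := by
  cases t with
  | var i => rfl
  | @func n g ts =>
    cases n with
    | zero =>
      simp only [Term.realize]
      rw [funMap_eq_coe_constants, funMap_eq_coe_constants, hf]
    | succ n => exact (hL n).elim g

/-- A positive formula true in `N` depends on finitely many elements and relation symbols only: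
approximate homomorphisms preserving that much of `N` preserve its truth. -/
theorem IsPositive.exists_preservesOn {n : ℕ} {φ : L.BoundedFormula α n} (hφ : IsPositive φ)
    (v : α → N) : ∀ xs : Fin n → N, φ.Realize v xs →
    ∃ (R : Finset (Σ k, L.Relations k)) (S : Finset N), ∀ (M : Type y) [L.Structure M] (f : N → M),
      PreservesOn R S f → φ.Realize (f ∘ v) (f ∘ xs) := by
  classical
  induction hφ with
  | bot => exact fun _ h => h.elim
  | top => exact fun _ _ => ⟨∅, ∅, fun _ _ _ _ => id⟩
  | equal t₁ t₂ =>
    intro xs h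
    refine ⟨∅, ∅, fun M _ f hf => ?_⟩
    rw [BoundedFormula.realize_bdEqual] at h ⊢
    rw [← Sum.comp_elim, realize_comp_of_map_constants hf.map_constants,
      realize_comp_of_map_constants hf.map_constants, h]
  | @rel n k R ts =>
    intro xs h
    rw [BoundedFormula.realize_rel] at h
    refine ⟨{⟨k, R⟩}, Finset.univ.image fun i => (ts i).realize (Sum.elim v xs),
      fun M _ f hf => ?_⟩
    rw [BoundedFormula.realize_rel, ← Sum.comp_elim]
    simp only [realize_comp_of_map_constants hf.map_constants]
    exact hf.map_rel R (by simp) _ (fun i => Finset.mem_image_of_mem _ (Finset.mem_univ i)) h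
  | inf _ _ ih₁ ih₂ =>
    intro xs h
    rw [BoundedFormula.realize_inf] at h
    obtain ⟨R₁, S₁, h₁⟩ := ih₁ xs h.1
    obtain ⟨R₂, S₂, h₂⟩ := ih₂ xs h.2
    refine ⟨R₁ ∪ R₂, S₁ ∪ S₂, fun M _ f hf => BoundedFormula.realize_inf.2 ⟨?_, ?_⟩⟩
    · exact h₁ M f (hf.mono Finset.subset_union_left Finset.subset_union_left)
    · exact h₂ M f (hf.mono Finset.subset_union_right Finset.subset_union_right)
  | sup _ _ ih₁ ih₂ =>
    intro xs h
    rcases BoundedFormula.realize_sup.1 h with h | h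
    · obtain ⟨R, S, hRS⟩ := ih₁ xs h
      exact ⟨R, S, fun M _ f hf => BoundedFormula.realize_sup.2 (.inl (hRS M f hf))⟩
    · obtain ⟨R, S, hRS⟩ := ih₂ xs h
      exact ⟨R, S, fun M _ f hf => BoundedFormula.realize_sup.2 (.inr (hRS M f hf))⟩
  | ex _ ih =>
    intro xs h
    obtain ⟨a, ha⟩ := BoundedFormula.realize_ex.1 h
    obtain ⟨R, S, hRS⟩ := ih _ ha
    refine ⟨R, S, fun M _ f hf => BoundedFormula.realize_ex.2 ⟨f a, ?_⟩⟩
    rw [← Fin.comp_snoc]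
    exact hRS M f hf

theorem IsPositive.exists_preservesOn_formula {φ : L.Formula α} (hφ : IsPositive φ) {v : α → N}
    (h : φ.Realize v) : ∃ (R : Finset (Σ k, L.Relations k)) (S : Finset N),
      ∀ (M : Type y) [L.Structure M] (f : N → M), PreservesOn R S f → φ.Realize (f ∘ v) := by
  obtain ⟨R, S, hRS⟩ := IsPositive.exists_preservesOn.{u, v, w, x, y} hφ v default h
  refine ⟨R, S, fun M _ f hf => ?_⟩
  have := hRS M f hf
  rwa [Subsingleton.elim (f ∘ default) default] at this

theorem IsPositive.realize_of_hom {φ : L.Formula α} (hφ : IsPositive φ) (f : N →[L] M) {v : α → N}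
    (h : φ.Realize v) : φ.Realize (f ∘ v) :=
  let ⟨R, S, hRS⟩ := hφ.exists_preservesOn_formula h
  hRS M f (preservesOn_hom f R S)

theorem IsPositive.realize_sentence_of_hom {φ : L.Sentence} (hφ : IsPositive φ) (f : N →[L] M)
    (h : N ⊨ φ) : M ⊨ φ := by
  have := hφ.realize_of_hom f h
  rwa [Subsingleton.elim (f ∘ default) default] at this

theorem model_negTheory_of_hom (f : N →[L] M) : N ⊨ negTheory L M :=
  model_negTheory_iff.2 fun _ hφ h => hφ.realize_sentence_of_hom f h

/-- The local version of compactness used throughout: the models of `Th₋(M)` are the structures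
whose finite pieces map to `M`. -/
theorem model_negTheory_iff_exists_preservesOn [Finite L.Constants] [Nonempty M] :
    N ⊨ negTheory L M ↔ ∀ (R : Finset (Σ k, L.Relations k)) (S : Finset N),
      ∃ f : N → M, PreservesOn R S f := by
  rw [model_negTheory_iff]
  constructor
  · intro h R S
    obtain ⟨σ, hσ, hN, hσM⟩ := exists_isPositive_forall_exists_preservesOn.{u, v, x, y} R S
    exact hσM M (h σ hσ hN)
  · intro h φ hφ hN
    obtain ⟨R, S, hRS⟩ := IsPositive.exists_preservesOn_formula.{u, v, 0, x, y} hφ hN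
    obtain ⟨f, hf⟩ := h R S
    have := hRS M f hf
    rwa [Subsingleton.elim (f ∘ default) default] at this

/-- Approximate homomorphisms into a structure with closed relations, taking each element into a
fixed compact set, have a limit, which is a homomorphism. -/
theorem exists_hom_of_isCompact [TopologicalSpace M] [T2Space M]
    (hM : ∀ {k : ℕ} (r : L.Relations k), IsClosed {xs : Fin k → M | Structure.RelMap r xs})
    (K : N → Set M) (hK : ∀ a, IsCompact (K a))
    (h : ∀ (R : Finset (Σ k, L.Relations k)) (S : Finset N),
      ∃ f : N → M, PreservesOn R S f ∧ ∀ a ∈ S, f a ∈ K a) : Nonempty (N →[L] M) := by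
  classical
  let ι := Finset (Σ k, L.Relations k) × Finset N
  choose g hg hgK using fun i : ι => h i.1 i.2
  -- an ultrafilter along which every finite amount of information is eventually preserved
  let U : Ultrafilter ι := Ultrafilter.of Filter.atTop
  have hU : ∀ i : ι, ∀ᶠ j in (U : Filter ι), i ≤ j := fun i =>
    Ultrafilter.of_le _ (Filter.eventually_ge_atTop i)
  have hlim : ∀ a, ∃ b, Filter.Tendsto (fun i => g i a) U (nhds b) := by
    intro a
    have hmem : ∀ᶠ i in (U : Filter ι), g i a ∈ K a := (hU (∅, {a})).mono fun i hi =>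
      hgK i a (hi.2 (Finset.mem_singleton_self a))
    obtain ⟨b, _, hb⟩ := (hK a).ultrafilter_le_nhds (U.map fun i => g i a)
      (Filter.le_principal_iff.2 hmem)
    exact ⟨b, hb⟩
  choose f hf using hlim
  refine ⟨⟨f, ?_, ?_⟩⟩
  · intro n c xs
    cases n with
    | zero =>
      rw [funMap_eq_coe_constants, funMap_eq_coe_constants]
      refine tendsto_nhds_unique (hf _) ?_
      simp only [(hg _).map_constants]
      exact tendsto_const_nhds
    | succ n => exact (hL n).elim c
  · intro k r xs hr
    refine (hM r).mem_of_tendsto (f := fun i => g i ∘ xs) (b := (U : Filter ι))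
      (tendsto_pi_nhds.2 fun i => hf (xs i)) ?_
    refine (hU ({⟨k, r⟩}, Finset.univ.image xs)).mono fun j hj => (hg j).map_rel r ?_ xs ?_ hr
    · exact hj.1 (Finset.mem_singleton_self _)
    · exact fun i => hj.2 (Finset.mem_image_of_mem _ (Finset.mem_univ i))

end General

/-! ### Positive embeddings -/

section PositiveEmbedding

variable {L : FirstOrder.Language.{u, v}} {A B : Type x} [L.Structure A] [L.Structure B]

/-- A homomorphism with approximate left inverses, exact on any given tuple, is a positive
embedding. -/
theorem isPositiveEmbedding_of_exists_preservesOn [∀ n, IsEmpty (L.Functions (n + 1))]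
    (f : A →[L] B)
    (h : ∀ (R : Finset (Σ k, L.Relations k)) (S : Finset B) (n : ℕ) (a : Fin n → A),
      ∃ g : B → A, PreservesOn R S g ∧ ∀ i, g (f (a i)) = a i) : IsPositiveEmbedding f := by
  intro n φ hφ a ha
  obtain ⟨R, S, hRS⟩ := IsPositive.exists_preservesOn_formula.{u, v, 0, x, x} hφ ha
  obtain ⟨g, hg, hga⟩ := h R S n a
  have := hRS A g hg
  rwa [show g ∘ (fun i => f (a i)) = a from funext hga] at this

/-- Positive embeddings reflect positive sentences. -/
theorem IsPositiveEmbedding.model_negTheory {f : A →[L] B} (hf : IsPositiveEmbedding f) :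
    B ⊨ negTheory L A := by
  refine model_negTheory_iff.2 fun φ hφ hB => ?_
  have h := hf 0 (Formula.relabel Empty.elim φ) (hφ.relabel _) Fin.elim0
    (by rw [Formula.realize_relabel, Subsingleton.elim (_ ∘ _) default]; exact hB)
  rwa [Formula.realize_relabel, Subsingleton.elim (_ ∘ _) default] at h

theorem IsPositiveEmbedding.negTheory_eq [∀ n, IsEmpty (L.Functions (n + 1))] {f : A →[L] B}
    (hf : IsPositiveEmbedding f) : negTheory L A = negTheory L B :=
  LocalPositiveLogic.negTheory_eq hf.model_negTheory (model_negTheory_of_hom f)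

end PositiveEmbedding

/-! ### Transfer of structures to higher universes -/

section ULift

variable {L : FirstOrder.Language.{u, v}} {M : Type y} [L.Structure M]

/-- The structure transported to the lift of the universe of `M`. -/
instance uliftStructure : L.Structure (ULift.{x} M) := Equiv.ulift.symm.inducedStructure

/-- The isomorphism between a structure and its lift to a higher universe. -/
def uliftEquiv : M ≃[L] ULift.{x} M := Equiv.ulift.symm.inducedStructureEquiv

theorem model_ulift_iff {T : L.Theory} : ULift.{x} M ⊨ T ↔ M ⊨ T :=
  ⟨fun _ => StrongHomClass.theory_model (uliftEquiv (L := L) (M := M)).symm,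
    fun _ => StrongHomClass.theory_model (uliftEquiv (L := L) (M := M))⟩

theorem negTheory_ulift : negTheory L (ULift.{x} M) = negTheory L M := by
  ext σ
  exact and_congr_right fun _ =>
    (StrongHomClass.realize_sentence (uliftEquiv (L := L) (M := M)) σ).symm

end ULift

/-! ### Locality relations and local models -/

namespace LocalSignature

variable {L : FirstOrder.Language.{u, v}} {D : Type w}
  [AddCommMonoid D] [PartialOrder D] [IsOrderedAddMonoid D] {S : LocalSignature L D}

theorem locRel_zero {M : Type x} [L.Structure M] {a b : M} : S.locRel 0 a b ↔ a = b := by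
  simp [locRel]

theorem locRel_of_ne_zero {M : Type x} [L.Structure M] {d : D} (hd : d ≠ 0) {a b : M} :
    S.locRel d a b ↔ Structure.RelMap (S.symb ⟨d, hd⟩) ![a, b] := by
  simp [locRel, hd]

theorem realize_locFormula {M : Type x} [L.Structure M] {α : Type} {d : D} {t₁ t₂ : L.Term α}
    {a : α → M} : (S.locFormula d t₁ t₂).Realize a ↔ S.locRel d (t₁.realize a) (t₂.realize a) := by
  rcases eq_or_ne d 0 with rfl | hd
  · simp [locFormula, locRel]
  · simp [locFormula, locRel, hd]

theorem locRel_hom {M : Type x} {N : Type y} [L.Structure M] [L.Structure N] (f : M →[L] N) {d : D}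
    {a b : M} (h : S.locRel d a b) : S.locRel d (f a) (f b) := by
  rcases eq_or_ne d 0 with rfl | hd
  · exact locRel_zero.2 (congrArg f (locRel_zero.1 h))
  · have := f.map_rel _ _ ((locRel_of_ne_zero hd).1 h)
    rw [locRel_of_ne_zero hd]
    convert this using 1
    funext i
    fin_cases i <;> rfl

theorem locRel_equiv {M : Type x} {N : Type y} [L.Structure M] [L.Structure N] (f : M ≃[L] N)
    {d : D} {a b : M} : S.locRel d (f a) (f b) ↔ S.locRel d a b :=
  ⟨fun h => by simpa using locRel_hom f.symm.toHom h, locRel_hom f.toHom⟩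

@[simp]
theorem locRel_up {M : Type y} [L.Structure M] {d : D} {a b : M} :
    S.locRel d (ULift.up.{x} a) (ULift.up.{x} b) ↔ S.locRel d a b :=
  locRel_equiv (uliftEquiv (L := L) (M := M))

theorem IsLocal.ulift {M : Type y} [L.Structure M] (h : S.IsLocal M) :
    S.IsLocal (ULift.{x} M) where
  nonempty := h.nonempty.map ULift.up
  symm := by
    rintro d ⟨a⟩ ⟨b⟩
    simpa using h.symm d a b
  mono := by
    rintro d₁ d₂ hd ⟨a⟩ ⟨b⟩
    simpa using h.mono d₁ d₂ hd a b
  comp := by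
    rintro d₁ d₂ ⟨a⟩ ⟨b⟩ ⟨c⟩
    simpa using h.comp d₁ d₂ a b c
  bound c₁ c₂ := by
    have := locRel_hom (uliftEquiv.{u, v, x, y} (L := L) (M := M)).toHom (h.bound c₁ c₂)
    simpa only [Hom.map_constants] using this
  total := by
    rintro ⟨a⟩ ⟨b⟩
    simpa using h.total a b

theorem IsLocalModel.ulift {T : L.Theory} {M : Type y} [L.Structure M] (h : S.IsLocalModel T M) :
    S.IsLocalModel T (ULift.{x} M) :=
  ⟨h.1.ulift, model_ulift_iff.2 h.2⟩

theorem IsLocalModel.locallySatisfiable {T : L.Theory} {M : Type} [L.Structure M]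
    (h : S.IsLocalModel T M) : LocallySatisfiable.{u, v, w, x} S T :=
  ⟨ULift.{x} M, inferInstance, h.ulift⟩

/-- A local structure is a local model of its own negative theory. -/
theorem IsLocal.isLocalModel {M : Type x} [L.Structure M] (h : S.IsLocal M) :
    S.IsLocalModel (negTheory L M) M :=
  ⟨h, model_negTheory_iff.2 fun _ _ => id⟩

/-- A set of negative sentences all of whose non-members fail in some local model is a negative
local theory. -/
theorem isNegativeLocalTheory_of_exists {T : L.Theory} (hT : ∀ σ ∈ T, IsNegative σ)
    (h : ∀ σ, IsNegative σ → σ ∉ T →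
      ∃ (M : Type) (_ : L.Structure M), S.IsLocalModel T M ∧ ¬ M ⊨ σ) :
    IsNegativeLocalTheory.{u, v, w, x} S T := by
  refine ⟨hT, fun σ hσ himp => ?_⟩
  by_contra hσT
  obtain ⟨M, _, hM, hMσ⟩ := h σ hσ hσT
  exact hMσ ((StrongHomClass.realize_sentence (uliftEquiv (L := L) (M := M)) σ).2
    (himp (ULift.{x} M) hM.ulift))

theorem IsLocal.isNegativeLocalTheory {M : Type} [L.Structure M] (h : S.IsLocal M) :
    IsNegativeLocalTheory.{u, v, w, x} S (negTheory L M) :=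
  isNegativeLocalTheory_of_exists (fun _ hσ => hσ.1) fun _ hσ hσT =>
    ⟨M, inferInstance, h.isLocalModel, fun hM => hσT ⟨hσ, hM⟩⟩

end LocalSignature

/-! ### Structures with locality relations indexed by `ℕ` and unary predicates -/

section ExLanguage

variable {C ι : Type}

instance isEmpty_exLanguage_functions (n : ℕ) : IsEmpty ((exLanguage C ι).Functions (n + 1)) :=
  inferInstanceAs (IsEmpty Empty)

instance finite_exLanguage_constants [h : Finite C] : Finite (exLanguage C ι).Constants := h

instance isEmpty_exLanguage_constants : IsEmpty (exLanguage Empty ι).Constants :=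
  inferInstanceAs (IsEmpty Empty)

/-- The interpretation in `N` of the `i`-th unary predicate. -/
def predRel {N : Type x} [(exLanguage C ι).Structure N] (i : ι) (a : N) : Prop :=
  Structure.RelMap (L := exLanguage C ι) (ExRelations.pred i) ![a]

variable {N : Type x} [(exLanguage C ι).Structure N] {M : Type y} [(exLanguage C ι).Structure M]

theorem relMap_pred {i : ι} {xs : Fin 1 → N} :
    Structure.RelMap (L := exLanguage C ι) (ExRelations.pred i) xs ↔
      predRel (C := C) i (xs 0) := by
  rw [predRel, ← List.ofFn_inj.1 (by simp : List.ofFn xs = List.ofFn ![xs 0])]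

theorem relMap_d {n : {n : ℕ // n ≠ 0}} {xs : Fin 2 → N} :
    Structure.RelMap (L := exLanguage C ι) (ExRelations.d n) xs ↔
      (exSignature C ι).locRel n.1 (xs 0) (xs 1) := by
  rw [LocalSignature.locRel_of_ne_zero n.2,
    ← List.ofFn_inj.1 (by simp : List.ofFn xs = List.ofFn ![xs 0, xs 1])]
  rfl

theorem predRel_hom (f : N →[exLanguage C ι] M) {i : ι} {a : N}
    (h : predRel (C := C) i a) : predRel (C := C) i (f a) :=
  relMap_pred.1 (f.map_rel _ _ h)

theorem predRel_up {i : ι} {a : N} :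
    predRel (C := C) i (ULift.up.{y} a) ↔ predRel (C := C) i a :=
  ⟨predRel_hom (uliftEquiv (L := exLanguage C ι) (M := N)).symm.toHom,
    predRel_hom (uliftEquiv (L := exLanguage C ι) (M := N)).toHom⟩

/-- Homomorphisms are the maps preserving constants, locality relations and predicates. -/
def exHom (f : N → M) (hc : ∀ c : (exLanguage C ι).Constants, f (c : N) = (c : M))
    (hd : ∀ n a b, (exSignature C ι).locRel n a b → (exSignature C ι).locRel n (f a) (f b))
    (hp : ∀ (i : ι) a, predRel (C := C) i a → predRel (C := C) i (f a)) :
    N →[exLanguage C ι] M where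
  toFun := f
  map_fun' {n} c xs := by
    cases n with
    | zero => rw [funMap_eq_coe_constants, funMap_eq_coe_constants, hc]
    | succ n => exact isEmptyElim c
  map_rel' {k} r xs h := by
    cases r with
    | d n => exact relMap_d.2 (hd _ _ _ (relMap_d.1 h))
    | pred i => exact relMap_pred.2 (hp _ _ (relMap_pred.1 h))

theorem preservesOn_exLanguage {R : Finset (Σ k, (exLanguage C ι).Relations k)} {S : Finset N}
    {f : N → M} (hc : ∀ c : (exLanguage C ι).Constants, f (c : N) = (c : M))
    (hd : ∀ n, ∀ a ∈ S, ∀ b ∈ S,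
      (exSignature C ι).locRel n a b → (exSignature C ι).locRel n (f a) (f b))
    (hp : ∀ i : ι, ⟨1, ExRelations.pred i⟩ ∈ R → ∀ a ∈ S,
      predRel (C := C) i a → predRel (C := C) i (f a)) :
    PreservesOn R S f := by
  refine ⟨hc, fun {k} r hr xs hxs h => ?_⟩
  cases r with
  | d n => exact relMap_d.2 (hd _ _ (hxs _) _ (hxs _) (relMap_d.1 h))
  | pred i => exact relMap_pred.2 (hp _ hr _ (hxs _) (relMap_pred.1 h))

open Classical in
/-- The relation symbols `d₁, …, dₖ` together with finitely many predicates. -/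
def exRels (C : Type) (k : ℕ) (I : Finset ι) : Finset (Σ k, (exLanguage C ι).Relations k) :=
  (Finset.range k).image (fun n => ⟨2, ExRelations.d ⟨n + 1, n.succ_ne_zero⟩⟩) ∪
    I.image fun i => ⟨1, ExRelations.pred i⟩

theorem PreservesOn.locRel {R : Finset (Σ k, (exLanguage C ι).Relations k)} {S : Finset N}
    {f : N → M} (h : PreservesOn R S f) {k n : ℕ} {I : Finset ι} (hR : exRels C k I ⊆ R)
    (hn : n ≤ k) {a b : N} (ha : a ∈ S) (hb : b ∈ S) (hab : (exSignature C ι).locRel n a b) :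
    (exSignature C ι).locRel n (f a) (f b) := by
  cases n with
  | zero =>
    rw [LocalSignature.locRel_zero] at hab ⊢
    rw [hab]
  | succ n =>
    classical
    have hmem : (⟨2, ExRelations.d ⟨n + 1, n.succ_ne_zero⟩⟩ : Σ k, (exLanguage C ι).Relations k) ∈
        exRels C k I :=
      Finset.mem_union_left _ (Finset.mem_image_of_mem _ (Finset.mem_range.2 hn))
    exact relMap_d.1 (h.map_rel _ (hR hmem) ![a, b] (by simp [Fin.forall_fin_two, ha, hb])
      (relMap_d.2 hab))

theorem PreservesOn.predRel {R : Finset (Σ k, (exLanguage C ι).Relations k)} {S : Finset N}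
    {f : N → M} (h : PreservesOn R S f) {k : ℕ} {i : ι} {I : Finset ι} (hR : exRels C k I ⊆ R)
    (hi : i ∈ I) {a : N} (ha : a ∈ S) (hia : predRel (C := C) i a) : predRel (C := C) i (f a) := by
  classical
  have hmem : (⟨1, ExRelations.pred i⟩ : Σ k, (exLanguage C ι).Relations k) ∈ exRels C k I :=
    Finset.mem_union_right _ (Finset.mem_image_of_mem _ hi)
  exact relMap_pred.1 (h.map_rel _ (hR hmem) ![a] (by simp [ha]) hia)

/-- Finitely many relation symbols involve boundedly many members of a sequence of predicates. -/
theorem exists_forall_pred_mem_le (R : Finset (Σ k, (exLanguage C ι).Relations k)) {j : ℕ → ι}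
    (hj : Function.Injective j) : ∃ K : ℕ, ∀ n, ⟨1, ExRelations.pred (j n)⟩ ∈ R → n ≤ K := by
  have hinj : Function.Injective
      (fun n => ⟨1, ExRelations.pred (j n)⟩ : ℕ → Σ k, (exLanguage C ι).Relations k) := by
    intro m n h
    exact hj (ExRelations.pred.inj (eq_of_heq (Sigma.mk.inj h).2))
  obtain ⟨K, hK⟩ := (R.finite_toSet.preimage hinj.injOn).bddAbove
  exact ⟨K, fun n hn => hK hn⟩

end ExLanguage

section ExStructure

variable {C ι M : Type} {c : C → M} {R : ℕ → M → M → Prop} {P : ι → Set M}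

theorem predRel_exStructure {i : ι} {a : M} :
    letI := exStructure M c R P
    predRel (C := C) i a ↔ a ∈ P i :=
  Iff.rfl

theorem locRel_exStructure (hR : ∀ a b, R 0 a b ↔ a = b) {n : ℕ} {a b : M} :
    letI := exStructure M c R P
    (exSignature C ι).locRel n a b ↔ R n a b := by
  let _ := exStructure M c R P
  rcases eq_or_ne n 0 with rfl | hn
  · rw [LocalSignature.locRel_zero, hR]
  · rw [LocalSignature.locRel_of_ne_zero hn]
    exact Iff.rfl

theorem isLocal_exStructure [Nonempty M] (hR : ∀ a b, R 0 a b ↔ a = b)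
    (hsymm : ∀ n a b, R n a b → R n b a) (hmono : ∀ m n, m ≤ n → ∀ a b, R m a b → R n a b)
    (hcomp : ∀ m n a b d, R m a b → R n b d → R (m + n) a d) (hc : ∀ i j, c i = c j)
    (htotal : ∀ a b, ∃ n, R n a b) :
    letI := exStructure M c R P
    (exSignature C ι).IsLocal M := by
  let _ := exStructure M c R P
  refine ⟨inferInstance, ?_, ?_, ?_, ?_, ?_⟩
  · simpa only [locRel_exStructure hR] using hsymm
  · simpa only [locRel_exStructure hR] using hmono
  · simpa only [locRel_exStructure hR] using hcomp
  · exact fun i j => (locRel_exStructure hR).2 ((hR _ _).2 (hc i j))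
  · simpa only [locRel_exStructure hR] using htotal

end ExStructure

/-! ### The structure on `ℤ` with locality relations `|a - b| ≤ n` -/

section IntDist

variable {C ι : Type} {c : C → ℤ} {P : ι → Set ℤ}

theorem intDist_zero (a b : ℤ) : intDist 0 a b ↔ a = b := by
  rw [intDist, abs_le]
  omega

theorem locRel_int {n : ℕ} {a b : ℤ} :
    letI := exStructure ℤ c intDist P
    (exSignature C ι).locRel n a b ↔ a - b ≤ n ∧ b - a ≤ n := by
  let _ := exStructure ℤ c intDist P
  rw [locRel_exStructure intDist_zero, intDist, abs_le]
  omega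

theorem isLocal_int (hc : ∀ i j, c i = c j) :
    letI := exStructure ℤ c intDist P
    (exSignature C ι).IsLocal ℤ := by
  refine isLocal_exStructure intDist_zero ?_ ?_ ?_ hc ?_
  · exact fun n a b h => by rwa [intDist, abs_sub_comm]
  · exact fun m n hmn a b h => h.trans (Int.ofNat_le.2 hmn)
  · intro m n a b d h₁ h₂
    rw [intDist, abs_le] at *
    omega
  · exact fun a b => ⟨(a - b).natAbs, by rw [intDist, Int.natCast_natAbs]⟩

end IntDist

/-! ### The theory of `ℤ` with the predicates `[n, ∞)` and `(-∞, -n]` -/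

theorem P_injective : Function.Injective PQ.P := fun _ _ => PQ.P.inj

theorem Q_injective : Function.Injective PQ.Q := fun _ _ => PQ.Q.inj

section Interval

attribute [local instance] intervalStructure

theorem isLocal_interval : (exSignature Empty PQ).IsLocal ℤ :=
  isLocal_int fun i => i.elim

theorem isNegativeLocalTheory_interval :
    (exSignature Empty PQ).IsNegativeLocalTheory.{0, 0, 0, x} intervalTheory :=
  isLocal_interval.isNegativeLocalTheory

theorem locallySatisfiable_interval :
    (exSignature Empty PQ).LocallySatisfiable.{0, 0, 0, x} intervalTheory :=
  isLocal_interval.isLocalModel.locallySatisfiable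

/-- In `ℤ` every element is pinned down by finitely many atomic facts: `0` is the only element of
`P₀ ∩ Q₀`, and `n` and `-n` are the only elements of `Pₙ` and `Qₙ` at distance `n` from it. Hence
approximate homomorphisms back to `ℤ` are exact inverses on any given tuple. -/
theorem isPCModel_interval : (exSignature Empty PQ).IsPCModel intervalTheory (ULift.{x} ℤ) := by
  classical
  refine ⟨isLocal_interval.isLocalModel.ulift, fun N _ hN f =>
    isPositiveEmbedding_of_exists_preservesOn f fun R S n a => ?_⟩
  let k : Fin n → ℕ := fun i => (a i).down.natAbs
  let I : Finset PQ := {PQ.P 0, PQ.Q 0} ∪ Finset.univ.image (fun i => PQ.P (k i)) ∪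
    Finset.univ.image fun i => PQ.Q (k i)
  obtain ⟨g, hg⟩ := model_negTheory_iff_exists_preservesOn.1 hN.2
    (R ∪ exRels Empty (Finset.univ.sup k) I) (insert (f ⟨0⟩) (S ∪ Finset.univ.image (f ∘ a)))
  have hR : exRels Empty (Finset.univ.sup k) I ⊆ R ∪ exRels Empty (Finset.univ.sup k) I :=
    Finset.subset_union_right
  have hpred : ∀ j ∈ I, ∀ b : ULift.{x} ℤ, f b ∈ insert (f ⟨0⟩) (S ∪ Finset.univ.image (f ∘ a)) →
      b.down ∈ intervalPred j → g (f b) ∈ intervalPred j := fun j hj b hb h =>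
    hg.predRel hR hj hb (predRel_hom f (predRel_up.2 h))
  have h0 : g (f ⟨0⟩) = 0 := by
    have h₁ := hpred (PQ.P 0) (by simp [I]) ⟨0⟩ (by simp) (by simp [intervalPred])
    have h₂ := hpred (PQ.Q 0) (by simp [I]) ⟨0⟩ (by simp) (by simp [intervalPred])
    simp only [intervalPred, Set.mem_ofPred_eq] at h₁ h₂
    omega
  refine ⟨fun b => ⟨g b⟩, ?_, fun i => ?_⟩
  · exact (hg.hom_comp (uliftEquiv (L := exLanguage Empty PQ) (M := ℤ)).toHom).mono
      Finset.subset_union_left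
      (Finset.subset_union_left.trans (Finset.subset_insert _ _))
  · have hmem : f (a i) ∈ insert (f ⟨0⟩) (S ∪ Finset.univ.image (f ∘ a)) := by simp
    have hd := hg.locRel hR (Finset.le_sup (Finset.mem_univ i)) (Finset.mem_insert_self _ _) hmem
      (LocalSignature.locRel_hom f (a := ⟨0⟩) (b := a i)
        (LocalSignature.locRel_up.2 (locRel_int.2 (by simp only [k]; omega))))
    rw [locRel_int, h0] at hd
    refine ULift.ext _ _ ?_
    rcases le_total 0 (a i).down with h | h
    · have := hpred (PQ.P (k i)) (by simp [I]) (a i) hmem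
        (by simp only [intervalPred, Set.mem_ofPred_eq, k]; omega)
      simp only [intervalPred, Set.mem_ofPred_eq, k] at this hd ⊢
      omega
    · have := hpred (PQ.Q (k i)) (by simp [I]) (a i) hmem
        (by simp only [intervalPred, Set.mem_ofPred_eq, k]; omega)
      simp only [intervalPred, Set.mem_ofPred_eq, k] at this hd ⊢
      omega

theorem weaklyComplete_interval :
    (exSignature Empty PQ).WeaklyComplete.{0, 0, 0, x} intervalTheory :=
  ⟨ULift.{x} ℤ, inferInstance, isPCModel_interval, negTheory_ulift.symm⟩

/-- The one-point structure at `+∞`: its point satisfies every `Pₙ` and no `Qₙ`. -/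
@[reducible]
def endStructure : (exLanguage Empty PQ).Structure Unit :=
  exStructure Unit Empty.elim (fun _ _ _ => True) fun
    | PQ.P _ => Set.univ
    | PQ.Q _ => ∅

attribute [local instance] endStructure

theorem isLocal_end : (exSignature Empty PQ).IsLocal Unit :=
  isLocal_exStructure (fun _ _ => by simp) (fun _ _ _ => id) (fun _ _ _ _ _ => id)
    (fun _ _ _ _ _ _ _ => trivial) (fun i => i.elim) fun _ _ => ⟨0, trivial⟩

theorem isLocalModel_end : (exSignature Empty PQ).IsLocalModel intervalTheory Unit := by
  refine ⟨isLocal_end, model_negTheory_iff_exists_preservesOn.2 fun R S => ?_⟩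
  obtain ⟨K, hK⟩ := exists_forall_pred_mem_le R P_injective
  refine ⟨fun _ => K, preservesOn_exLanguage isEmptyElim (fun m _ _ _ _ _ => ?_) ?_⟩
  · exact locRel_int.2 (by omega)
  · rintro (n | n) hn _ _ h
    · exact Int.ofNat_le.2 (hK n hn)
    · exact h.elim

/-- In a local model no element lies in some `Qₘ` if another lies in all `Pₙ`. -/
theorem not_predRel_Q {N : Type x} [(exLanguage Empty PQ).Structure N]
    (hN : (exSignature Empty PQ).IsLocalModel intervalTheory N) {p : N}
    (hp : ∀ n, predRel (C := Empty) (PQ.P n) p) (m : ℕ) (q : N) :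
    ¬ predRel (C := Empty) (PQ.Q m) q := by
  classical
  intro hq
  obtain ⟨d, hd⟩ := hN.1.total p q
  obtain ⟨g, hg⟩ := model_negTheory_iff_exists_preservesOn.1 hN.2
    (exRels Empty d {PQ.P (d + 1), PQ.Q m}) {p, q}
  have h₁ := hg.locRel subset_rfl le_rfl (by simp) (by simp) hd
  have h₂ : g p ∈ intervalPred (PQ.P (d + 1)) :=
    predRel_exStructure.1 (hg.predRel subset_rfl (by simp) (by simp) (hp (d + 1)))
  have h₃ : g q ∈ intervalPred (PQ.Q m) := hg.predRel subset_rfl (by simp) (by simp) hq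
  rw [locRel_int] at h₁
  simp only [intervalPred, Set.mem_ofPred_eq] at h₂ h₃
  omega

/-- Every local model into which the point at `+∞` maps retracts onto it. -/
theorem isPCModel_end : (exSignature Empty PQ).IsPCModel intervalTheory (ULift.{x} Unit) := by
  refine ⟨isLocalModel_end.ulift, fun N _ hN f n φ hφ a ha => ?_⟩
  have hp : ∀ n, predRel (C := Empty) (PQ.P n) (f ⟨()⟩) := fun n =>
    predRel_hom f (predRel_up.2 trivial)
  let g : N →[exLanguage Empty PQ] ULift.{x} Unit := exHom (fun _ => ⟨()⟩) isEmptyElim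
    (fun _ _ _ _ => LocalSignature.locRel_up.2 ((locRel_exStructure fun _ _ => by simp).2 trivial))
    (by
      rintro (n | n) b h
      · exact predRel_up.2 trivial
      · exact (not_predRel_Q hN hp n b h).elim)
  exact hφ.realize_of_hom g ha

theorem not_complete_interval :
    ¬ (exSignature Empty PQ).Complete.{0, 0, 0, x} intervalTheory := by
  classical
  intro h
  have hT : negTheory (exLanguage Empty PQ) ℤ = negTheory _ Unit :=
    (h _ isPCModel_end).trans negTheory_ulift
  have hZ : ℤ ⊨ negTheory (exLanguage Empty PQ) Unit := hT ▸ isLocal_interval.isLocalModel.2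
  obtain ⟨g, hg⟩ := model_negTheory_iff_exists_preservesOn.1 hZ
    (exRels Empty 0 {PQ.Q 0}) {0}
  have h₀ : (0 : ℤ) ∈ intervalPred (PQ.Q 0) := by simp [intervalPred]
  exact hg.predRel (i := PQ.Q 0) subset_rfl (by simp) (Finset.mem_singleton_self _) h₀

end Interval

/-! ### The theory of the pointed line -/

section PointedInterval

attribute [local instance] pointedIntervalStructure

theorem isLocal_pointedInterval : (exSignature Unit PQ).IsLocal ℤ :=
  isLocal_int fun _ _ => rfl

theorem isNegativeLocalTheory_pointedInterval :
    (exSignature Unit PQ).IsNegativeLocalTheory.{0, 0, 0, x} pointedIntervalTheory :=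
  isLocal_pointedInterval.isNegativeLocalTheory

theorem locallySatisfiable_pointedInterval :
    (exSignature Unit PQ).LocallySatisfiable.{0, 0, 0, x} pointedIntervalTheory :=
  isLocal_pointedInterval.isLocalModel.locallySatisfiable

/-- The image of an element at distance `m` from the constant is confined to the finite set
`[-m, m]`, so approximate homomorphisms to `ℤ` have a limit. -/
theorem nonempty_hom_pointedInterval {N : Type x} [(exLanguage Unit PQ).Structure N]
    (hN : (exSignature Unit PQ).IsLocalModel pointedIntervalTheory N) :
    Nonempty (N →[exLanguage Unit PQ] ℤ) := by
  classical
  let c : (exLanguage Unit PQ).Constants := ()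
  choose m hm using fun a : N => hN.1.total (c : N) a
  refine exists_hom_of_isCompact (fun r => isClosed_discrete _)
    (fun a => Set.Icc (-(m a : ℤ)) (m a)) (fun a => isCompact_Icc) fun R S => ?_
  obtain ⟨g, hg⟩ := model_negTheory_iff_exists_preservesOn.1 hN.2
    (R ∪ exRels Unit (S.sup m) ∅) (insert (c : N) S)
  refine ⟨g, hg.mono Finset.subset_union_left (Finset.subset_insert _ _), fun a ha => ?_⟩
  have h := hg.locRel Finset.subset_union_right (Finset.le_sup ha) (Finset.mem_insert_self _ _)
    (Finset.mem_insert_of_mem ha) (hm a)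
  have hc : g (c : N) = 0 := hg.map_constants c
  rw [hc, locRel_int] at h
  rw [Set.mem_Icc]
  omega

theorem ljcp_pointedInterval :
    (exSignature Unit PQ).LJCP.{0, 0, 0, x} pointedIntervalTheory := by
  intro A B _ _ hA hB
  obtain ⟨f⟩ := nonempty_hom_pointedInterval hA
  obtain ⟨g⟩ := nonempty_hom_pointedInterval hB
  exact ⟨ULift.{x} ℤ, inferInstance, isLocal_pointedInterval.isLocalModel.ulift,
    ⟨uliftEquiv.toHom.comp f⟩, ⟨uliftEquiv.toHom.comp g⟩⟩

end PointedInterval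

/-! ### Failure of uniform irreducibility -/

section Irreducibility

variable {C ι : Type} {M : Type x} [(exLanguage C ι).Structure M]

/-- The atomic formula asserting that a single variable satisfies the `i`-th predicate. -/
def predFormula (C : Type) {ι : Type} (i : ι) : (exLanguage C ι).Formula (Fin 1) :=
  Relations.formula (L := exLanguage C ι) (ExRelations.pred i) fun _ => Term.var 0

theorem isPositive_predFormula (i : ι) : IsPositive (predFormula C i) := .rel _ _

theorem realize_predFormula {i : ι} {a : Fin 1 → M} :
    (predFormula C i).Realize a ↔ predRel (C := C) i (a 0) :=
  Formula.realize_rel.trans relMap_pred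

theorem realize_existsAll_predFormula {i : ι} :
    M ⊨ existsAll (predFormula C i) ↔ ∃ a : M, predRel (C := C) i a := by
  simp only [realize_existsAll, realize_predFormula]
  exact ⟨fun ⟨a, ha⟩ => ⟨a 0, ha⟩, fun ⟨a, ha⟩ => ⟨fun _ => a, ha⟩⟩

end Irreducibility

section PointedIrreducibility

attribute [local instance] pointedIntervalStructure

/-- The sets `P_{d+1}` and `Q₀` are non-empty at distance `d + 1` from each other. -/
theorem not_uniformlyIrreducible_pointedInterval :
    ¬ (exSignature Unit PQ).UniformlyIrreducible pointedIntervalTheory := by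
  rintro ⟨d, hd⟩
  have h := hd 1 (predFormula Unit (PQ.P (d + 1))) (predFormula Unit (PQ.Q 0))
    (isPositive_predFormula _) (isPositive_predFormula _)
    ⟨(isPositive_predFormula _).existsAll,
      (not_mem_negTheory (isPositive_predFormula _).existsAll).2
        (realize_existsAll_predFormula.2 ⟨((d + 1 : ℕ) : ℤ), le_refl ((d + 1 : ℕ) : ℤ)⟩)⟩
    ⟨(isPositive_predFormula _).existsAll,
      (not_mem_negTheory (isPositive_predFormula _).existsAll).2
        (realize_existsAll_predFormula.2 ⟨(0 : ℤ), by
          change (0 : ℤ) ≤ -((0 : ℕ) : ℤ)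
          simp⟩)⟩
  obtain ⟨a, ha⟩ := realize_existsAll.1 ((not_mem_negTheory h.1).1 h.2)
  simp only [LocalSignature.locTupleFormula, Formula.realize_inf, Formula.realize_iInf,
    Formula.realize_relabel, realize_predFormula, LocalSignature.realize_locFormula, Term.realize_var] at ha
  obtain ⟨h₁, h₂, h₃⟩ := ha
  have h₁ := locRel_int.1 (h₁ 0)
  replace h₂ : ((d + 1 : ℕ) : ℤ) ≤ a (Sum.inl 0) := h₂
  replace h₃ : a (Sum.inr 0) ≤ -((0 : ℕ) : ℤ) := h₃
  omega

end PointedIrreducibility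

/-! ### The Hamming structure on `2^ω` -/

theorem hammingDist_zero (η ζ : ℕ → Bool) : hammingDist 0 η ζ ↔ η = ζ := by
  simp [hammingDist, Set.encard_eq_zero, Set.eq_empty_iff_forall_notMem, funext_iff]

theorem hammingDist_symm {n : ℕ} {η ζ : ℕ → Bool} (h : hammingDist n η ζ) :
    hammingDist n ζ η := by
  simpa only [hammingDist, ne_comm] using h

theorem hammingDist_mono {m n : ℕ} (hmn : m ≤ n) {η ζ : ℕ → Bool} (h : hammingDist m η ζ) :
    hammingDist n η ζ :=
  h.trans (Nat.cast_le.2 hmn)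

theorem hammingDist_comp {m n : ℕ} {η ζ θ : ℕ → Bool} (h₁ : hammingDist m η ζ)
    (h₂ : hammingDist n ζ θ) : hammingDist (m + n) η θ := by
  have hsub : {i | η i ≠ θ i} ⊆ {i | η i ≠ ζ i} ∪ {i | ζ i ≠ θ i} := by
    intro i hi
    by_contra h
    simp only [Set.mem_union, Set.mem_ofPred_eq, not_or, not_not] at h
    exact hi (h.1.trans h.2)
  calc {i | η i ≠ θ i}.encard ≤ ({i | η i ≠ ζ i} ∪ {i | ζ i ≠ θ i}).encard := Set.encard_le_encard hsub
    _ ≤ _ := Set.encard_union_le _ _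
    _ ≤ (m : ℕ∞) + n := add_le_add h₁ h₂
    _ = ((m + n : ℕ) : ℕ∞) := (Nat.cast_add m n).symm

/-- Hamming distance at most `n` is a condition on the sets of `n + 1` coordinates. -/
theorem hammingDist_iff {n : ℕ} {η ζ : ℕ → Bool} :
    hammingDist n η ζ ↔ ∀ t : Finset ℕ, t.card = n + 1 → ∃ i ∈ t, η i = ζ i := by
  constructor
  · intro h t ht
    by_contra! hne
    have hsub : (t : Set ℕ) ⊆ {i | η i ≠ ζ i} := fun i hi => hne i hi
    have := (Set.encard_le_encard hsub).trans h
    rw [Set.encard_coe_eq_coe_finsetCard, ht, Nat.cast_le] at this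
    omega
  · intro h
    by_contra hlt
    rw [hammingDist, not_le] at hlt
    obtain ⟨t, hsub, ht⟩ := Set.exists_subset_encard_eq (k := ((n + 1 : ℕ) : ℕ∞))
      (by push_cast; exact Order.add_one_le_of_lt hlt)
    have hfin : t.Finite := Set.finite_of_encard_eq_coe ht
    rw [hfin.encard_eq_coe_toFinset_card, Nat.cast_inj] at ht
    obtain ⟨i, hi, heq⟩ := h _ ht
    exact hsub (hfin.mem_toFinset.1 hi) heq

/-- The sequence equal to `ζ` on the first `K` coordinates and to `η` on the others. -/
def splice (K : ℕ) (η ζ : ℕ → Bool) : ℕ → Bool := fun i => if i < K then ζ i else η i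

theorem hammingDist_splice (K : ℕ) (η ζ : ℕ → Bool) : hammingDist K η (splice K η ζ) := by
  have hsub : {i | η i ≠ splice K η ζ i} ⊆ (Finset.range K : Set ℕ) := by
    intro i hi
    by_contra h
    rw [Finset.coe_range, Set.mem_Iio] at h
    exact hi (by simp [splice, h])
  refine (Set.encard_le_encard hsub).trans ?_
  rw [Set.encard_coe_eq_coe_finsetCard, Finset.card_range]

theorem hammingDist_splice_splice {n : ℕ} (K : ℕ) (η : ℕ → Bool) {ζ θ : ℕ → Bool}
    (h : hammingDist n ζ θ) : hammingDist n (splice K η ζ) (splice K η θ) := by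
  refine (Set.encard_le_encard fun i hi => ?_).trans h
  rintro heq
  refine hi ?_
  simp only [splice, heq]

/-- The sequences at finite Hamming distance from `η`. -/
def Component (η : ℕ → Bool) : Type := {ζ : ℕ → Bool // ∃ n, hammingDist n η ζ}

instance nonempty_component (η : ℕ → Bool) : Nonempty (Component η) :=
  ⟨⟨η, 0, (hammingDist_zero η η).2 rfl⟩⟩

/-- The Hamming distance on a component. -/
def componentDist {η : ℕ → Bool} (n : ℕ) (a b : Component η) : Prop := hammingDist n a.1 b.1

theorem componentDist_zero {η : ℕ → Bool} (a b : Component η) : componentDist 0 a b ↔ a = b :=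
  (hammingDist_zero _ _).trans Subtype.ext_iff.symm

/-- The component of `η` as a substructure of `2^ω`. -/
@[reducible]
instance componentStructure (η : ℕ → Bool) : (exLanguage Empty PQ).Structure (Component η) :=
  exStructure (Component η) Empty.elim componentDist fun i => {a | a.1 ∈ cantorPred i}

section Hamming

attribute [local instance] hammingStructure

variable {η : ℕ → Bool}

theorem locRel_component {n : ℕ} {a b : Component η} :
    (exSignature Empty PQ).locRel n a b ↔ hammingDist n a.1 b.1 :=
  locRel_exStructure componentDist_zero

theorem locRel_hamming {n : ℕ} {ζ θ : ℕ → Bool} :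
    (exSignature Empty PQ).locRel n ζ θ ↔ hammingDist n ζ θ :=
  locRel_exStructure hammingDist_zero

theorem isLocal_component (η : ℕ → Bool) : (exSignature Empty PQ).IsLocal (Component η) :=
  isLocal_exStructure componentDist_zero
    (fun _ _ _ => hammingDist_symm) (fun _ _ hmn _ _ => hammingDist_mono hmn)
    (fun _ _ _ _ _ => hammingDist_comp) (fun i => isEmptyElim i) fun a b =>
    let ⟨m, hm⟩ := a.2
    let ⟨n, hn⟩ := b.2
    ⟨m + n, hammingDist_comp (hammingDist_symm hm) hn⟩

/-- The inclusion of a component into `2^ω`. -/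
def componentHom (η : ℕ → Bool) : Component η →[exLanguage Empty PQ] (ℕ → Bool) :=
  exHom (fun a => a.1) isEmptyElim (fun _ _ _ h => locRel_hamming.2 (locRel_component.1 h))
    fun _ _ h => h

/-- Replacing all coordinates beyond the finitely many in play by those of `η` maps finite pieces
of `2^ω` into the component of `η`; so all components have the theory of `2^ω`. -/
theorem negTheory_component (η : ℕ → Bool) :
    negTheory (exLanguage Empty PQ) (Component η) = hammingTheory := by
  refine (negTheory_eq (model_negTheory_of_hom (componentHom η))
    (model_negTheory_iff_exists_preservesOn.2 fun R S => ?_)).symm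
  obtain ⟨K₁, hK₁⟩ := exists_forall_pred_mem_le R P_injective
  obtain ⟨K₂, hK₂⟩ := exists_forall_pred_mem_le R Q_injective
  refine ⟨fun ζ => ⟨splice (max K₁ K₂ + 1) η ζ, _, hammingDist_splice _ _ _⟩,
    preservesOn_exLanguage isEmptyElim (fun n ζ _ θ _ h => ?_) ?_⟩
  · exact locRel_component.2 (hammingDist_splice_splice _ _ (locRel_hamming.1 h))
  · rintro (n | n) hn ζ _ h
    · have hlt : n < max K₁ K₂ + 1 := Nat.lt_succ_of_le ((hK₁ n hn).trans (le_max_left _ _))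
      exact (if_pos hlt).trans h
    · have hlt : n < max K₁ K₂ + 1 := Nat.lt_succ_of_le ((hK₂ n hn).trans (le_max_right _ _))
      exact (if_pos hlt).trans h

theorem isLocalModel_component (η : ℕ → Bool) :
    (exSignature Empty PQ).IsLocalModel hammingTheory (Component η) :=
  negTheory_component η ▸ (isLocal_component η).isLocalModel

theorem isClosed_relMap_hamming {k : ℕ} (r : (exLanguage Empty PQ).Relations k) :
    IsClosed {xs : Fin k → ℕ → Bool | Structure.RelMap r xs} := by
  cases r with
  | d n =>
    have : {xs : Fin 2 → ℕ → Bool | Structure.RelMap (L := exLanguage Empty PQ)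
        (ExRelations.d n) xs} = ⋂ (t : Finset ℕ) (_ : t.card = n.1 + 1),
          ⋃ i ∈ t, {xs | xs 0 i = xs 1 i} := by
      ext xs
      simp only [Set.mem_ofPred_eq, Set.mem_iInter, Set.mem_iUnion, exists_prop]
      exact hammingDist_iff
    rw [this]
    exact isClosed_iInter fun t => isClosed_iInter fun _ => t.finite_toSet.isClosed_biUnion
      fun i _ => isClosed_eq (by fun_prop) (by fun_prop)
  | pred j =>
    cases j with
    | P n =>
      exact isClosed_eq (f := fun xs : Fin 1 → ℕ → Bool => xs 0 n) (by fun_prop)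
        continuous_const
    | Q n =>
      exact isClosed_eq (f := fun xs : Fin 1 → ℕ → Bool => xs 0 n) (by fun_prop)
        continuous_const

/-- By compactness of `2^ω`, local models map to `2^ω`; being local, they map to a component. -/
theorem exists_hom_component {N : Type x} [(exLanguage Empty PQ).Structure N]
    (hN : (exSignature Empty PQ).IsLocalModel hammingTheory N) :
    ∃ η, Nonempty (N →[exLanguage Empty PQ] Component η) := by
  obtain ⟨f⟩ := exists_hom_of_isCompact (N := N) isClosed_relMap_hamming (fun _ => Set.univ)
    (fun _ => isCompact_univ) fun R S =>
      (model_negTheory_iff_exists_preservesOn.1 hN.2 R S).imp fun f hf => ⟨hf, fun _ _ => trivial⟩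
  obtain ⟨a₀⟩ := hN.1.nonempty
  refine ⟨f a₀, ⟨exHom (fun a => ⟨f a, ?_⟩) isEmptyElim (fun n a b h => ?_) fun i a h => ?_⟩⟩
  · exact (hN.1.total a₀ a).imp fun n h => locRel_hamming.1 (LocalSignature.locRel_hom f h)
  · exact locRel_component.2 (locRel_hamming.1 (LocalSignature.locRel_hom f h))
  · exact predRel_hom f h

theorem complete_hamming : (exSignature Empty PQ).Complete.{0, 0, 0, x} hammingTheory := by
  intro M _ hM
  obtain ⟨η, ⟨f⟩⟩ := exists_hom_component hM.1
  have := (hM.2 (ULift.{x} (Component η)) (isLocalModel_component η).ulift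
    (uliftEquiv.toHom.comp f)).negTheory_eq
  rw [this, negTheory_ulift, negTheory_component]

/-- The components of the two constant sequences have no common continuation: in a local model, an
element lying in all `Pₙ` would be at finite distance from one lying in all `Qₙ`. -/
theorem not_ljcp_hamming : ¬ (exSignature Empty PQ).LJCP.{0, 0, 0, x} hammingTheory := by
  classical
  intro h
  let η : Bool → ℕ → Bool := fun b _ => b
  let e : ∀ b, Component (η b) := fun b => ⟨η b, 0, (hammingDist_zero _ _).2 rfl⟩
  obtain ⟨N, _, hN, ⟨f⟩, ⟨g⟩⟩ := h _ _ (isLocalModel_component (η true)).ulift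
    (isLocalModel_component (η false)).ulift
  have hf : ∀ n, predRel (C := Empty) (PQ.P n) (f ⟨e true⟩) := fun n =>
    predRel_hom f (predRel_up.2 (show η true n = true from rfl))
  have hg : ∀ n, predRel (C := Empty) (PQ.Q n) (g ⟨e false⟩) := fun n =>
    predRel_hom g (predRel_up.2 (show η false n = false from rfl))
  obtain ⟨d, hd⟩ := hN.1.total (f ⟨e true⟩) (g ⟨e false⟩)
  obtain ⟨k, hk⟩ := model_negTheory_iff_exists_preservesOn.1 hN.2
    (exRels Empty d ((Finset.range (d + 1)).image PQ.P ∪ (Finset.range (d + 1)).image PQ.Q))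
    {f ⟨e true⟩, g ⟨e false⟩}
  obtain ⟨i, hi, heq⟩ := hammingDist_iff.1
    (locRel_hamming.1 (hk.locRel subset_rfl le_rfl (by simp) (by simp) hd))
    (Finset.range (d + 1)) (Finset.card_range _)
  have h₁ : k (f ⟨e true⟩) i = true := (hk.predRel (i := PQ.P i) subset_rfl
    (Finset.mem_union_left _ (Finset.mem_image_of_mem _ hi)) (by simp) (hf i))
  have h₂ : k (g ⟨e false⟩) i = false := (hk.predRel (i := PQ.Q i) subset_rfl
    (Finset.mem_union_right _ (Finset.mem_image_of_mem _ hi)) (by simp) (hg i))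
  rw [h₁, h₂] at heq
  exact Bool.noConfusion heq

end Hamming

/-! ### Lines with uncountably many disjoint predicates -/

section Disjoint

/-- The structure on `ℤ` with unary predicates `P`. -/
@[reducible]
def lineStructure (P : OmegaOne → Set ℤ) : (exLanguage Empty OmegaOne).Structure ℤ :=
  exStructure ℤ Empty.elim intDist P

/-- The predicates are pairwise disjoint. -/
def IsDisjointFamily (P : OmegaOne → Set ℤ) : Prop :=
  ∀ α β : OmegaOne, α < β → P α ∩ P β = ∅

theorem IsDisjointFamily.eq {P : OmegaOne → Set ℤ} (hP : IsDisjointFamily P) {α β : OmegaOne}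
    {a : ℤ} (hα : a ∈ P α) (hβ : a ∈ P β) : α = β := by
  rcases lt_trichotomy α β with h | h | h
  · exact (Set.eq_empty_iff_forall_notMem.1 (hP α β h) a ⟨hα, hβ⟩).elim
  · exact h
  · exact (Set.eq_empty_iff_forall_notMem.1 (hP β α h) a ⟨hβ, hα⟩).elim

theorem isDisjointFamily_of_eq {P : OmegaOne → Set ℤ}
    (hP : ∀ α β a, a ∈ P α → a ∈ P β → α = β) : IsDisjointFamily P := fun α β h =>
  Set.eq_empty_iff_forall_notMem.2 fun a ha => h.ne (hP α β a ha.1 ha.2)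

theorem not_mem_disjointTheory {φ : (exLanguage Empty OmegaOne).Sentence} (hφ : IsPositive φ) :
    BoundedFormula.not φ ∉ disjointTheory ↔
      ∃ P, IsDisjointFamily P ∧ letI := lineStructure P; ℤ ⊨ φ := by
  constructor
  · intro h
    by_contra! h'
    exact h ⟨⟨φ, hφ, rfl⟩, fun P hP =>
      let _ := lineStructure P
      (Sentence.realize_not ℤ).2 (h' P hP)⟩
  · rintro ⟨P, hP, h⟩ hmem
    let _ := lineStructure P
    exact (Sentence.realize_not ℤ).1 (hmem.2 P hP) h

theorem isLocalModel_line {P : OmegaOne → Set ℤ} (hP : IsDisjointFamily P) :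
    letI := lineStructure P
    (exSignature Empty OmegaOne).IsLocalModel disjointTheory ℤ :=
  let _ := lineStructure P
  ⟨isLocal_int fun i => i.elim, (Theory.model_iff _).2 fun _ hσ => hσ.2 P hP⟩

theorem isNegativeLocalTheory_disjoint :
    (exSignature Empty OmegaOne).IsNegativeLocalTheory.{0, 0, 0, x} disjointTheory := by
  refine LocalSignature.isNegativeLocalTheory_of_exists (fun σ hσ => hσ.1) fun σ hσ hσT => ?_
  obtain ⟨φ, hφ, rfl⟩ := hσ
  obtain ⟨P, hP, h⟩ := (not_mem_disjointTheory hφ).1 hσT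
  let _ := lineStructure P
  exact ⟨ℤ, lineStructure P, isLocalModel_line hP, fun h' => (Sentence.realize_not ℤ).1 h' h⟩

theorem locallySatisfiable_disjoint :
    (exSignature Empty OmegaOne).LocallySatisfiable.{0, 0, 0, x} disjointTheory :=
  let _ := lineStructure fun _ => ∅
  (isLocalModel_line (P := fun _ => ∅) fun _ _ _ => Set.empty_inter _).locallySatisfiable

/-- A translation of `ℤ` respects the predicates on finite sets if these are transported. -/
theorem preservesOn_translation {P P' : OmegaOne → Set ℤ}
    {R : Finset (Σ k, (exLanguage Empty OmegaOne).Relations k)} {S : Finset ℤ} {t : ℤ}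
    (h : ∀ α, ∀ a ∈ S, a ∈ P α → a + t ∈ P' α) :
    @PreservesOn _ ℤ ℤ (lineStructure P) (lineStructure P') R S fun a => a + t := by
  let A := lineStructure P
  let B := lineStructure P'
  refine @preservesOn_exLanguage Empty OmegaOne ℤ A ℤ B R S _ isEmptyElim (fun n a _ b _ hab => ?_)
    fun α _ a ha => h α a ha
  refine (@locRel_int _ _ _ P' _ _ _).2 ?_
  have := (@locRel_int _ _ _ P _ _ _).1 hab
  omega

/-- Finite witnesses of two positive formulas on two lines can be placed far apart on a single
line. -/
theorem irreducible_disjoint : (exSignature Empty OmegaOne).Irreducible disjointTheory := by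
  classical
  rintro n φ ψ hφ hψ ⟨hφ', hφT⟩ ⟨hψ', hψT⟩
  have hpos := (IsPositive.inf (hφ.relabel (Sum.inl : Fin n → Fin n ⊕ Fin n))
    (hψ.relabel (Sum.inr : Fin n → Fin n ⊕ Fin n)))
  obtain ⟨P₁, hP₁, h₁⟩ := (not_mem_disjointTheory hφ').1 hφT
  obtain ⟨P₂, hP₂, h₂⟩ := (not_mem_disjointTheory hψ').1 hψT
  obtain ⟨a, ha⟩ := (@realize_existsAll _ ℤ (lineStructure P₁) _ _ _).1 h₁
  obtain ⟨b, hb⟩ := (@realize_existsAll _ ℤ (lineStructure P₂) _ _ _).1 h₂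
  obtain ⟨R₁, S₁, hRS₁⟩ := @IsPositive.exists_preservesOn_formula.{0, 0, 0, 0, 0} _ _ ℤ
    (lineStructure P₁) _ _ hφ _ ha
  obtain ⟨R₂, S₂, hRS₂⟩ := @IsPositive.exists_preservesOn_formula.{0, 0, 0, 0, 0} _ _ ℤ
    (lineStructure P₂) _ _ hψ _ hb
  obtain ⟨t, ht⟩ : ∃ t : ℤ, ∀ c ∈ S₁, ∀ d ∈ S₂, c ≠ d + t := by
    obtain ⟨t, ht⟩ := Infinite.exists_notMem_finset
      ((S₁ ×ˢ S₂).image fun p => p.1 - p.2)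
    refine ⟨t, fun c hc d hd h => ht (Finset.mem_image.2
      ⟨(c, d), Finset.mem_product.2 ⟨hc, hd⟩, by simp [h]⟩)⟩
  let P : OmegaOne → Set ℤ := fun α => {c | c ∈ S₁ ∧ c ∈ P₁ α} ∪ {c | c - t ∈ S₂ ∧ c - t ∈ P₂ α}
  have hP : IsDisjointFamily P := by
    refine isDisjointFamily_of_eq fun α β c => ?_
    rintro (⟨hS, hα⟩ | ⟨hS, hα⟩) (⟨hS', hβ⟩ | ⟨hS', hβ⟩)
    · exact hP₁.eq hα hβ
    · exact (ht _ hS _ hS' (by simp)).elim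
    · exact (ht _ hS' _ hS (by simp)).elim
    · exact hP₂.eq hα hβ
  refine ⟨hpos.existsAll, (not_mem_disjointTheory hpos.existsAll).2 ⟨P, hP, ?_⟩⟩
  let _ := lineStructure P
  have k₁ := hRS₁ ℤ _ (preservesOn_translation (P' := P) (t := 0) fun α c hc hα =>
    Or.inl (by simpa using ⟨hc, hα⟩))
  have k₂ := hRS₂ ℤ _ (preservesOn_translation (P' := P) (t := t) fun α c hc hα =>
    Or.inr (by simpa using ⟨hc, hα⟩))
  refine realize_existsAll.2 ⟨Sum.elim ((· + 0) ∘ a) ((· + t) ∘ b), ?_⟩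
  rw [Formula.realize_inf, Formula.realize_relabel, Formula.realize_relabel]
  exact ⟨k₁, k₂⟩

/-- A local structure with theory `disjointTheory` would be a countable union of balls which meet
every `P_α`. Then some ball of radius `d` meets infinitely many `P_α`, whereas in a line it meets
at most `2d + 1` of them. -/
theorem negTheory_ne_disjointTheory {N : Type x} [(exLanguage Empty OmegaOne).Structure N]
    (hN : (exSignature Empty OmegaOne).IsLocal N) : disjointTheory ≠ negTheory _ N := by
  classical
  intro hT
  obtain ⟨p⟩ := hN.nonempty
  have hmeet : ∀ α : OmegaOne, ∃ q : N, predRel (C := Empty) α q := by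
    intro α
    have hpos := (isPositive_predFormula (C := Empty) α).existsAll
    refine realize_existsAll_predFormula.1 ((not_mem_negTheory hpos).1 (hT ▸ ?_))
    refine (not_mem_disjointTheory hpos).2 ⟨fun β => {a | α = β}, ?_, ?_⟩
    · exact isDisjointFamily_of_eq fun β γ _ hβ hγ => Eq.trans (Eq.symm hβ) hγ
    · let _ := lineStructure fun β => {a | α = β}
      exact realize_existsAll_predFormula.2 ⟨(0 : ℤ), rfl⟩
  choose q hq using hmeet
  choose d hd using fun α => hN.total p (q α)
  have : Uncountable OmegaOne := by
    rw [← Cardinal.aleph0_lt_mk_iff, Cardinal.mk_toType]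
    simp
  obtain ⟨m, hm⟩ : ∃ m, ¬ (d ⁻¹' {m}).Countable := by
    by_contra! h
    refine Set.not_countable_univ (α := OmegaOne) ?_
    rw [show Set.univ = ⋃ m, d ⁻¹' {m} by ext; simp]
    exact Set.countable_iUnion h
  -- one predicate more than the `2m + 1` elements of an interval of radius `m` in `ℤ`
  obtain ⟨I, hI, hcard⟩ := (show (d ⁻¹' {m}).Infinite from
    fun hfin => hm hfin.countable).exists_subset_card_eq (2 * m + 2)
  have hdI : ∀ α ∈ I, (exSignature Empty OmegaOne).locRel m p (q α) := fun α hα =>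
    (show d α = m from hI hα) ▸ hd α
  obtain ⟨σ, hσ, hNσ, h⟩ := exists_isPositive_forall_exists_preservesOn.{0, 0, x, 0}
    (exRels Empty m I) (insert p (I.image q))
  obtain ⟨P, hP, hPσ⟩ := (not_mem_disjointTheory hσ).1 (hT ▸ (not_mem_negTheory hσ).2 hNσ)
  let _ := lineStructure P
  obtain ⟨g, hg⟩ := h ℤ hPσ
  have hmem : ∀ α ∈ I, q α ∈ insert p (I.image q) := fun α hα =>
    Finset.mem_insert_of_mem (Finset.mem_image_of_mem _ hα)
  have hgP : ∀ α ∈ I, g (q α) ∈ P α := fun α hα =>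
    predRel_exStructure.1 (hg.predRel subset_rfl hα (hmem α hα) (hq α))
  have hle : I.card ≤ (Finset.Icc (g p - m) (g p + m)).card := by
    refine Finset.card_le_card_of_injOn (g ∘ q) (fun α hα => ?_) fun α hα β hβ heq => ?_
    · have := locRel_int.1
        (hg.locRel subset_rfl le_rfl (Finset.mem_insert_self _ _) (hmem α hα) (hdI α hα))
      rw [Finset.mem_coe, Finset.mem_Icc, Function.comp_apply]
      omega
    · exact hP.eq (hgP α hα) ((show g (q α) = g (q β) from heq) ▸ hgP β hβ)
  rw [hcard, Int.card_Icc] at hle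
  omega

theorem not_weaklyComplete_disjoint :
    ¬ (exSignature Empty OmegaOne).WeaklyComplete.{0, 0, 0, x} disjointTheory :=
  fun ⟨_, _, hM, hT⟩ => negTheory_ne_disjointTheory hM.1.1 hT

end Disjoint

end LocalPositiveLogic

end

/-! ### The four theories separate the completeness properties -/

theorem mainTheorem4 :
    -- (wC) does not imply (C)
    ((exSignature Empty PQ).IsNegativeLocalTheory.{0, 0, 0, x} intervalTheory ∧
      (exSignature Empty PQ).LocallySatisfiable.{0, 0, 0, x} intervalTheory ∧
      (exSignature Empty PQ).WeaklyComplete.{0, 0, 0, x} intervalTheory ∧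
      ¬ (exSignature Empty PQ).Complete.{0, 0, 0, x} intervalTheory) ∧
    -- (LJCP) does not imply (UI)
    ((exSignature Unit PQ).IsNegativeLocalTheory.{0, 0, 0, x} pointedIntervalTheory ∧
      (exSignature Unit PQ).LocallySatisfiable.{0, 0, 0, x} pointedIntervalTheory ∧
      (exSignature Unit PQ).LJCP.{0, 0, 0, x} pointedIntervalTheory ∧
      ¬ (exSignature Unit PQ).UniformlyIrreducible pointedIntervalTheory) ∧
    -- (C) does not imply (LJCP)
    ((exSignature Empty PQ).IsNegativeLocalTheory.{0, 0, 0, x} hammingTheory ∧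
      (exSignature Empty PQ).LocallySatisfiable.{0, 0, 0, x} hammingTheory ∧
      (exSignature Empty PQ).Complete.{0, 0, 0, x} hammingTheory ∧
      ¬ (exSignature Empty PQ).LJCP.{0, 0, 0, x} hammingTheory) ∧
    -- (I) does not imply (wC)
    ((exSignature Empty OmegaOne).IsNegativeLocalTheory.{0, 0, 0, x} disjointTheory ∧
      (exSignature Empty OmegaOne).LocallySatisfiable.{0, 0, 0, x} disjointTheory ∧
      (exSignature Empty OmegaOne).Irreducible disjointTheory ∧
      ¬ (exSignature Empty OmegaOne).WeaklyComplete.{0, 0, 0, x} disjointTheory) := 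
  ⟨⟨isNegativeLocalTheory_interval, locallySatisfiable_interval,
      weaklyComplete_interval, not_complete_interval⟩,
    ⟨isNegativeLocalTheory_pointedInterval, locallySatisfiable_pointedInterval,
      ljcp_pointedInterval,
      not_uniformlyIrreducible_pointedInterval⟩,
    ⟨negTheory_component (fun _ => false) ▸ (isLocal_component _).isNegativeLocalTheory,
      (isLocalModel_component fun _ => false).locallySatisfiable, complete_hamming,
      not_ljcp_hamming⟩,
    ⟨isNegativeLocalTheory_disjoint, locallySatisfiable_disjoint, irreducible_disjoint,
      not_weaklyComplete_disjoint⟩⟩
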